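/- Let $M$ be a connected smooth manifold of dimension $3$ with an almost paracontact metric structure $(\varphi,\xi,\eta,g)$: $\varphi$ is a smooth $(1,1)$-tensor field, $\xi$ a smooth vector field, $\eta$ a smooth $1$-form and $g$ a pseudo-Riemannian metric such that $$\varphi\xi=0,\qquad \eta\circ\varphi=0,\qquad \eta(\xi)=1,\qquad \varphi^2=\mathrm{Id}-\eta\otimes\xi,\qquad g(\varphi X,\varphi Y)=-g(X,Y)+\eta(X)\eta(Y),$$ and the eigenspaces of $\varphi|_{\ker\eta}$ for the eigenvalues $1$ and $-1$ have equal dimension at every point. Assume that the structure is normal, that is, $[\varphi,\varphi]-2\,d\eta\otimes\xi=0$, where $[\varphi,\varphi]$ is the Nijenhuis torsion of $\varphi$ and $2\,d\eta(X,Y)=X(\eta(Y))-Y(\eta(X))-\eta([X,Y])$. Assume moreover that $\xi$ is a conformal Killing vector field, that is, $\mathcal L_\xi g=f\,g$ for some smooth function $f$ on $M$. Then $\xi$ is a Killing vector field: $\mathcal L_\xi g=0$. If, in addition, $(M,\varphi,\xi,\eta,g)$ is an almost paracontact Ricci soliton, that is, $\mathcal L_\xi g+\varrho=\lambda g$ for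 some real constant $\lambda$, where $\varrho$ is the Ricci tensor of $g$, then the soliton is trivial: $g$ is Einstein ($\varrho=c\,g$ for a real constant $c$), and $(M,g)$ has constant sectional curvature $k$ for some $k\le 0$, that is, every nondegenerate tangent plane has sectional curvature $k$. (Signs are such that round spheres have positive sectional and Ricci curvature.) -/

import Mathlib

open scoped Manifold ContDiff Bundle

set_option maxSynthPendingDepth 3

noncomputable section

section MetricCoefficients

variable {E : Type*} [NormedAddCommGroup E] [NormedSpace ℝ E]

/-! ### Levi-Civita connection and curvature of metric coefficients on a vector space

`G x` is a nondegenerate symmetric bilinear form on `E` depending smoothly on `x : E`. -/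

namespace MetricCoefficients

variable (G : E → E →L[ℝ] E →L[ℝ] ℝ)

/-- The swap of the last two arguments, `T ↦ ((u, v, w) ↦ T u w v)`. -/
def swapLast (T : E →L[ℝ] E →L[ℝ] E →L[ℝ] ℝ) : E →L[ℝ] E →L[ℝ] E →L[ℝ] ℝ :=
  (ContinuousLinearMap.flipₗᵢ ℝ E E ℝ).toLinearIsometry.toContinuousLinearMap ∘L T

/-- The Christoffel symbols of the first kind,
`Γ(u, v; w) = (D_u G (v, w) + D_v G (u, w) - D_w G (u, v)) / 2`. -/
def christoffelFirst (x : E) : E →L[ℝ] E →L[ℝ] E →L[ℝ] ℝ :=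
  (2⁻¹ : ℝ) • (fderiv ℝ G x + (fderiv ℝ G x).flip - swapLast (fderiv ℝ G x).flip)

/-- The Christoffel symbols of the Levi-Civita connection, as the bilinear map `(u, v) ↦ Γ(u, v)`
with `G (Γ(u, v), w) = Γ(u, v; w)`: the covariant derivative is `∇_u Y = D_u Y + Γ(u, Y)`.
The index is raised by the inverse of the isomorphism `v ↦ G (v, ·)`. -/
def christoffel (x : E) : E →L[ℝ] E →L[ℝ] E :=
  ContinuousLinearMap.compL ℝ E (E →L[ℝ] ℝ) E (G x).inverse ∘L christoffelFirst G x

/-- The curvature, as the linear map `u ↦ R(u, v) w`, where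
`R(X, Y) Z = ∇_X ∇_Y Z - ∇_Y ∇_X Z - ∇_{[X, Y]} Z` is evaluated on constant (hence commuting)
vector fields `u, v, w` on `E`. -/
def curvature (x v w : E) : E →ₗ[ℝ] E where
  toFun u := fderiv ℝ (christoffel G) x u v w - fderiv ℝ (christoffel G) x v u w
    + christoffel G x u (christoffel G x v w) - christoffel G x v (christoffel G x u w)
  map_add' a b := by
    simp only [map_add, add_apply]
    abel
  map_smul' c a := by
    simp only [map_smul, smul_apply, RingHom.id_apply, smul_add, smul_sub]

/-- Check of the definition: the explicit formula for the Christoffel symbols of the first kind. -/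
theorem christoffelFirst_apply (x u v w : E) :
    christoffelFirst G x u v w =
      2⁻¹ * (fderiv ℝ G x u v w + fderiv ℝ G x v u w - fderiv ℝ G x w u v) := by
  simp [christoffelFirst, swapLast]

/-- The characterization of the Christoffel symbols at a point where `G` is nondegenerate. -/
theorem christoffel_spec [FiniteDimensional ℝ E] (x : E) (h : ∀ u, (∀ v, G x u v = 0) → u = 0)
    (u v w : E) : G x (christoffel G x u v) w = christoffelFirst G x u v w := by
  have hinj : Function.Injective (G x).toLinearMap := by
    rw [← LinearMap.ker_eq_bot, LinearMap.ker_eq_bot']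
    intro a ha
    exact h a fun b ↦ by simpa using congrArg (fun l : E →L[ℝ] ℝ ↦ l b) ha
  have hfin : Module.finrank ℝ E = Module.finrank ℝ (E →L[ℝ] ℝ) := by
    rw [← (LinearMap.toContinuousLinearMap (𝕜 := ℝ) (E := E) (F' := ℝ)).finrank_eq]
    exact Subspace.dual_finrank_eq.symm
  let e : E ≃L[ℝ] (E →L[ℝ] ℝ) :=
    (LinearEquiv.ofInjectiveOfFinrankEq (G x).toLinearMap hinj hfin).toContinuousLinearEquiv
  have he : G x = (e : E →L[ℝ] (E →L[ℝ] ℝ)) := by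
    ext a b
    rfl
  have h1 : christoffel G x u v = (G x).inverse (christoffelFirst G x u v) := rfl
  rw [h1]
  have h2 : ∀ l, G x ((G x).inverse l) = l := by
    intro l
    rw [he, ContinuousLinearMap.inverse_equiv]
    exact e.apply_symm_apply l
  rw [h2]

end MetricCoefficients

end MetricCoefficients

section Geometry

variable {E : Type*} [NormedAddCommGroup E] [NormedSpace ℝ E] [FiniteDimensional ℝ E]
  {M : Type*} [TopologicalSpace M] [ChartedSpace E M]

/-- `X` is a smooth vector field on `M`. -/
def IsSmoothVectorField [IsManifold 𝓘(ℝ, E) ∞ M]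
    (X : ∀ p : M, TangentSpace 𝓘(ℝ, E) p) : Prop :=
  ContMDiff 𝓘(ℝ, E) 𝓘(ℝ, E).tangent ∞ (fun p ↦ (⟨p, X p⟩ : TangentBundle 𝓘(ℝ, E) M))

variable (E M) in
/-- A pseudo-Riemannian metric: a smooth field of symmetric nondegenerate bilinear forms on the
tangent spaces. On a connected manifold its signature is constant. -/
structure PseudoRiemannianMetric [IsManifold 𝓘(ℝ, E) ∞ M] where
  /-- The bilinear form on each tangent space. -/
  form : ∀ p : M, TangentSpace 𝓘(ℝ, E) p →L[ℝ] TangentSpace 𝓘(ℝ, E) p →L[ℝ] ℝ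
  symm : ∀ (p : M) (u v : TangentSpace 𝓘(ℝ, E) p), form p u v = form p v u
  nondegenerate : ∀ (p : M) (u : TangentSpace 𝓘(ℝ, E) p), (∀ v, form p u v = 0) → u = 0
  smooth : ContMDiff 𝓘(ℝ, E) (𝓘(ℝ, E).prod 𝓘(ℝ, E →L[ℝ] E →L[ℝ] ℝ)) ∞
    (fun p ↦ Bundle.TotalSpace.mk' (E →L[ℝ] E →L[ℝ] ℝ)
      (E := fun p : M ↦
        (TangentSpace 𝓘(ℝ, E) p →L[ℝ] TangentSpace 𝓘(ℝ, E) p →L[ℝ] ℝ)) p (form p))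

namespace PseudoRiemannianMetric

variable [IsManifold 𝓘(ℝ, E) ∞ M] (g : PseudoRiemannianMetric E M)

/-! ### Lie derivative of the metric -/

/-- The Lie derivative of the metric along `V`, evaluated on vector fields:
`(𝓛_V g)(X, Y) = V (g (X, Y)) - g ([V, X], Y) - g (X, [V, Y])`. -/
def lieDeriv (V X Y : ∀ p : M, TangentSpace 𝓘(ℝ, E) p) (p : M) : ℝ :=
  mvfderiv 𝓘(ℝ, E) (fun q : M ↦ g.form q (X q) (Y q)) p (V p)
    - g.form p (VectorField.mlieBracket 𝓘(ℝ, E) V X p) (Y p)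
    - g.form p (X p) (VectorField.mlieBracket 𝓘(ℝ, E) V Y p)

/-- `V` is a Killing vector field: `𝓛_V g = 0`. -/
def IsKilling (V : ∀ p : M, TangentSpace 𝓘(ℝ, E) p) : Prop :=
  ∀ X Y, IsSmoothVectorField X → IsSmoothVectorField Y → ∀ p, g.lieDeriv V X Y p = 0

/-- `V` is a conformal Killing vector field: `𝓛_V g = f g` for some smooth function `f`. -/
def IsConformalKilling (V : ∀ p : M, TangentSpace 𝓘(ℝ, E) p) : Prop :=
  ∃ f : M → ℝ, ContMDiff 𝓘(ℝ, E) 𝓘(ℝ, ℝ) ∞ f ∧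
    ∀ X Y, IsSmoothVectorField X → IsSmoothVectorField Y →
      ∀ p, g.lieDeriv V X Y p = f p * g.form p (X p) (Y p)

/-! ### Curvature, in the chart centred at the point where it is evaluated -/

/-- The coefficients of the metric in the chart at `p`: the pullback of `g` under the inverse of
this chart, a bilinear form on `E` at each point `x` of the chart's target. -/
def inChart (p : M) (x : E) : E →L[ℝ] E →L[ℝ] ℝ :=
  let D : E →L[ℝ] TangentSpace 𝓘(ℝ, E) ((extChartAt 𝓘(ℝ, E) p).symm x) :=
    mfderiv 𝓘(ℝ, E) 𝓘(ℝ, E) (extChartAt 𝓘(ℝ, E) p).symm x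
  (ContinuousLinearMap.precomp ℝ D) ∘L g.form ((extChartAt 𝓘(ℝ, E) p).symm x) ∘L D

/-- The curvature tensor at `p`, as the linear map `u ↦ R(u, v) w` on tangent vectors: the curvature
of the coefficients of `g` in the chart at `p`, carried to the tangent space by the derivative of
this chart. -/
def curvature (p : M) (v w : TangentSpace 𝓘(ℝ, E) p) :
    TangentSpace 𝓘(ℝ, E) p →ₗ[ℝ] TangentSpace 𝓘(ℝ, E) p :=
  let D : TangentSpace 𝓘(ℝ, E) p →L[ℝ] E := mfderiv 𝓘(ℝ, E) 𝓘(ℝ, E) (extChartAt 𝓘(ℝ, E) p) p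
  D.inverse.toLinearMap ∘ₗ
    MetricCoefficients.curvature (g.inChart p) (extChartAt 𝓘(ℝ, E) p p) (D v) (D w) ∘ₗ
      D.toLinearMap

/-- The Ricci tensor `ϱ(v, w) = tr (u ↦ R(u, v) w)`. -/
def ricci (p : M) (v w : TangentSpace 𝓘(ℝ, E) p) : ℝ :=
  LinearMap.trace ℝ (TangentSpace 𝓘(ℝ, E) p) (g.curvature p v w)

/-- The sectional curvature of the plane spanned by `u` and `v`; it is meaningful when the metric
is nondegenerate on that plane. The sign is such that round spheres have positive curvature. -/
def sectionalCurvature (p : M) (u v : TangentSpace 𝓘(ℝ, E) p) : ℝ :=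
  g.form p (g.curvature p v v u) u / (g.form p u u * g.form p v v - g.form p u v ^ 2)

/-- All nondegenerate tangent planes, at all points, have sectional curvature `k`. -/
def HasConstantSectionalCurvature (k : ℝ) : Prop :=
  ∀ (p : M) (u v : TangentSpace 𝓘(ℝ, E) p),
    g.form p u u * g.form p v v - g.form p u v ^ 2 ≠ 0 → g.sectionalCurvature p u v = k

/-- The metric is Einstein: `ϱ = c g` for a constant `c`. -/
def IsEinstein : Prop :=
  ∃ c : ℝ, ∀ (p : M) (u v : TangentSpace 𝓘(ℝ, E) p), g.ricci p u v = c * g.form p u v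

/-- The vector field `V` satisfies the Ricci soliton equation `𝓛_V g + ϱ = c g` with some real
constant `c`. -/
def IsRicciSoliton (V : ∀ p : M, TangentSpace 𝓘(ℝ, E) p) : Prop :=
  ∃ c : ℝ, ∀ X Y, IsSmoothVectorField X → IsSmoothVectorField Y →
    ∀ p, g.lieDeriv V X Y p + g.ricci p (X p) (Y p) = c * g.form p (X p) (Y p)

end PseudoRiemannianMetric

variable (E M) in
/-- An almost paracontact metric structure `(φ, ξ, η, g)`. -/
structure AlmostParacontactMetricStructure [IsManifold 𝓘(ℝ, E) ∞ M] where
  /-- The `(1,1)`-tensor. -/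
  φ : ∀ p : M, TangentSpace 𝓘(ℝ, E) p →L[ℝ] TangentSpace 𝓘(ℝ, E) p
  /-- The Reeb vector field. -/
  ξ : ∀ p : M, TangentSpace 𝓘(ℝ, E) p
  /-- The one-form. -/
  η : ∀ p : M, TangentSpace 𝓘(ℝ, E) p →L[ℝ] ℝ
  /-- The compatible metric. -/
  g : PseudoRiemannianMetric E M
  smooth_φ : ContMDiff 𝓘(ℝ, E) (𝓘(ℝ, E).prod 𝓘(ℝ, E →L[ℝ] E)) ∞
    (fun p ↦ Bundle.TotalSpace.mk' (E →L[ℝ] E)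
      (E := fun p : M ↦ (TangentSpace 𝓘(ℝ, E) p →L[ℝ] TangentSpace 𝓘(ℝ, E) p)) p (φ p))
  smooth_ξ : IsSmoothVectorField ξ
  smooth_η : ContMDiff 𝓘(ℝ, E) (𝓘(ℝ, E).prod 𝓘(ℝ, E →L[ℝ] ℝ)) ∞
    (fun p ↦ Bundle.TotalSpace.mk' (E →L[ℝ] ℝ)
      (E := fun p : M ↦ (TangentSpace 𝓘(ℝ, E) p →L[ℝ] ℝ)) p (η p))
  φ_ξ : ∀ p, φ p (ξ p) = 0
  η_φ : ∀ p v, η p (φ p v) = 0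
  η_ξ : ∀ p, η p (ξ p) = 1
  φ_sq : ∀ p v, φ p (φ p v) = v - η p v • ξ p
  /-- The eigenspaces of `φ` on `ker η` for the eigenvalues `1` and `-1` have equal dimension. -/
  finrank_eigenspace : ∀ p,
    Module.finrank ℝ
      ↥((η p).toLinearMap.ker ⊓ Module.End.eigenspace (φ p).toLinearMap 1) =
    Module.finrank ℝ
      ↥((η p).toLinearMap.ker ⊓ Module.End.eigenspace (φ p).toLinearMap (-1))
  compatible : ∀ p u v, g.form p (φ p u) (φ p v) = -g.form p u v + η p u * η p v

namespace AlmostParacontactMetricStructure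

variable [IsManifold 𝓘(ℝ, E) ∞ M] (S : AlmostParacontactMetricStructure E M)

/-- The exterior derivative of `η`, with the convention
`2 dη(X, Y) = X (η Y) - Y (η X) - η [X, Y]`. -/
def dη (X Y : ∀ p : M, TangentSpace 𝓘(ℝ, E) p) (p : M) : ℝ :=
  2⁻¹ * (mvfderiv 𝓘(ℝ, E) (fun q : M ↦ S.η q (Y q)) p (X p)
    - mvfderiv 𝓘(ℝ, E) (fun q : M ↦ S.η q (X q)) p (Y p)
    - S.η p (VectorField.mlieBracket 𝓘(ℝ, E) X Y p))

/-- The Nijenhuis torsion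
`[φ, φ](X, Y) = φ² [X, Y] + [φ X, φ Y] - φ [φ X, Y] - φ [X, φ Y]`. -/
def nijenhuis (X Y : ∀ p : M, TangentSpace 𝓘(ℝ, E) p) (p : M) : TangentSpace 𝓘(ℝ, E) p :=
  S.φ p (S.φ p (VectorField.mlieBracket 𝓘(ℝ, E) X Y p))
    + VectorField.mlieBracket 𝓘(ℝ, E) (fun q ↦ S.φ q (X q)) (fun q ↦ S.φ q (Y q)) p
    - S.φ p (VectorField.mlieBracket 𝓘(ℝ, E) (fun q ↦ S.φ q (X q)) Y p)
    - S.φ p (VectorField.mlieBracket 𝓘(ℝ, E) X (fun q ↦ S.φ q (Y q)) p)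

/-- The structure is normal: `[φ, φ] - 2 dη ⊗ ξ = 0`. -/
def IsNormal : Prop :=
  ∀ X Y, IsSmoothVectorField X → IsSmoothVectorField Y →
    ∀ p, S.nijenhuis X Y p - (2 * S.dη X Y p) • S.ξ p = 0

end AlmostParacontactMetricStructure

end Geometry

end

/-! Compatibility makes `ξ` a unit field with metric dual `η`. Evaluating `𝓛_ξ g = f g` on `(ξ, ξ)`
gives `f = 0`, since `g (ξ, ξ)` is constant and `[ξ, ξ] = 0`; so `ξ` is Killing, and the soliton
equation becomes `ϱ = c g`.

In dimension three the Ricci tensor determines the curvature: the diagonal Ricci entries in an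
orthogonal basis are linear in the three sectional curvatures, and solving gives constant curvature
`c / 2` (`sectional_eq_of_ricci_eq`).

For the sign, a unit Killing field has a skew covariant derivative `A = ∇ξ` with `A ξ = 0` and `g
(R(u, ξ) ξ, u) = g (A u, A u)` (`curvature_of_unit_killing`). If `u` is orthogonal to `ξ` and not
null, then `φ u` is orthogonal to both and has square `-g (u, u)`. Hence `A u = t φ u`, so `g (A u,
A u) = -t² g (u, u)` and `c / 2 = -t²` (`apply_self_of_skew`). The opposite sign of the square of `φ
u` is what makes the curvature nonpositive. -/

section MetricCalculus

variable {E : Type*} [NormedAddCommGroup E] [NormedSpace ℝ E]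

/-! ### Levi-Civita calculus for metric coefficients on an open set -/

namespace MetricCoefficients

/-- `G` is a smooth field of symmetric nondegenerate bilinear forms on the open set `U`. -/
structure IsMetricOn (G : E → E →L[ℝ] E →L[ℝ] ℝ) (U : Set E) : Prop where
  isOpen : IsOpen U
  contDiffOn : ContDiffOn ℝ ∞ G U
  symm : ∀ x ∈ U, ∀ u v, G x u v = G x v u
  nondegenerate : ∀ x ∈ U, ∀ u, (∀ v, G x u v = 0) → u = 0

/-- The covariant derivative `∇_u Y = D_u Y + Γ(u, Y)` at the point `x`. -/
noncomputable def covDeriv (G : E → E →L[ℝ] E →L[ℝ] ℝ) (Y : E → E) (x : E) : E →L[ℝ] E :=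
  fderiv ℝ Y x + (christoffel G x).flip (Y x)

theorem covDeriv_apply (G : E → E →L[ℝ] E →L[ℝ] ℝ) (Y : E → E) (x u : E) :
    covDeriv G Y x u = fderiv ℝ Y x u + christoffel G x u (Y x) := rfl

/-- The product rule for the evaluation of a field of bilinear forms on two vector fields. -/
theorem fderiv_bilin_apply {G : E → E →L[ℝ] E →L[ℝ] ℝ} {a b : E → E} {x : E}
    (hG : DifferentiableAt ℝ G x) (ha : DifferentiableAt ℝ a x) (hb : DifferentiableAt ℝ b x)
    (u : E) :
    fderiv ℝ (fun y ↦ G y (a y) (b y)) x u =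
      fderiv ℝ G x u (a x) (b x) + G x (fderiv ℝ a x u) (b x) + G x (a x) (fderiv ℝ b x u) := by
  have h := ((hG.hasFDerivAt.clm_apply ha.hasFDerivAt).clm_apply hb.hasFDerivAt).fderiv
  rw [h]
  simp
  ring

namespace IsMetricOn

variable {G : E → E →L[ℝ] E →L[ℝ] ℝ} {U : Set E} (hG : IsMetricOn G U) {x : E} (hx : x ∈ U)

include hG hx

theorem contDiffAt : ContDiffAt ℝ ∞ G x := hG.contDiffOn.contDiffAt (hG.isOpen.mem_nhds hx)

theorem differentiableAt : DifferentiableAt ℝ G x :=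
  (hG.contDiffAt hx).differentiableAt (by simp)

theorem eq_of_forall_apply_eq {a b : E} (h : ∀ w, G x a w = G x b w) : a = b :=
  sub_eq_zero.mp (hG.nondegenerate x hx _ fun w ↦ by simp [h w])

theorem fderiv_symm (u v w : E) : fderiv ℝ G x u v w = fderiv ℝ G x u w v := by
  have h1 := fderiv_bilin_apply (hG.differentiableAt hx) (differentiableAt_const v)
    (differentiableAt_const w) u
  have h2 := fderiv_bilin_apply (hG.differentiableAt hx) (differentiableAt_const w)
    (differentiableAt_const v) u
  have h3 : (fun y ↦ G y v w) =ᶠ[nhds x] fun y ↦ G y w v := by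
    filter_upwards [hG.isOpen.mem_nhds hx] with y hy using hG.symm y hy v w
  rw [h3.fderiv_eq] at h1
  simp at h1 h2
  rw [← h1, ← h2]

variable [FiniteDimensional ℝ E]

theorem christoffel_symm (u v : E) : christoffel G x u v = christoffel G x v u := by
  refine hG.eq_of_forall_apply_eq hx fun w ↦ ?_
  rw [christoffel_spec G x (hG.nondegenerate x hx), christoffel_spec G x (hG.nondegenerate x hx),
    christoffelFirst_apply, christoffelFirst_apply, hG.fderiv_symm hx w u v]
  ring

/-- In `Γ(u, v; w) + Γ(u, w; v)` everything cancels except the derivative along `u`. This is metric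
compatibility on constant fields. -/
theorem fderiv_eq (u v w : E) :
    fderiv ℝ G x u v w = G x (christoffel G x u v) w + G x v (christoffel G x u w) := by
  rw [hG.symm x hx v, christoffel_spec G x (hG.nondegenerate x hx),
    christoffel_spec G x (hG.nondegenerate x hx), christoffelFirst_apply, christoffelFirst_apply,
    hG.fderiv_symm hx w u v, hG.fderiv_symm hx v u w, hG.fderiv_symm hx u w v]
  ring

/-- The Levi-Civita connection is compatible with the metric. -/
theorem fderiv_apply_apply {a b : E → E} (ha : DifferentiableAt ℝ a x)
    (hb : DifferentiableAt ℝ b x) (u : E) :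
    fderiv ℝ (fun y ↦ G y (a y) (b y)) x u =
      G x (covDeriv G a x u) (b x) + G x (a x) (covDeriv G b x u) := by
  rw [fderiv_bilin_apply (hG.differentiableAt hx) ha hb, hG.fderiv_eq hx, covDeriv_apply,
    covDeriv_apply]
  simp
  ring

theorem isInvertible : (G x).IsInvertible := by
  have hinj : Function.Injective (G x).toLinearMap := by
    rw [← LinearMap.ker_eq_bot, LinearMap.ker_eq_bot']
    intro a ha
    exact hG.nondegenerate x hx a fun b ↦ by
      simpa using congrArg (fun l : E →L[ℝ] ℝ ↦ l b) ha
  have hfin : Module.finrank ℝ E = Module.finrank ℝ (E →L[ℝ] ℝ) := by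
    rw [← (LinearMap.toContinuousLinearMap (𝕜 := ℝ) (E := E) (F' := ℝ)).finrank_eq]
    exact Subspace.dual_finrank_eq.symm
  exact ⟨(LinearEquiv.ofInjectiveOfFinrankEq (G x).toLinearMap hinj hfin).toContinuousLinearEquiv,
    by ext; rfl⟩

set_option synthInstance.maxHeartbeats 200000 in
theorem contDiffAt_christoffel : ContDiffAt ℝ ∞ (christoffel G) x := by
  have : CompleteSpace E := FiniteDimensional.complete ℝ E
  have hd : ContDiffAt ℝ ∞ (fderiv ℝ G) x := (hG.contDiffAt hx).fderiv_right (by simp)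
  have hflip : ContDiffAt ℝ ∞ (fun y ↦ (fderiv ℝ G y).flip) x :=
    ((ContinuousLinearMap.flipₗᵢ ℝ E E (E →L[ℝ] ℝ)).contDiff.contDiffAt).comp x hd
  have hswap : ContDiffAt ℝ ∞ (fun y ↦ swapLast (fderiv ℝ G y).flip) x :=
    contDiffAt_const.clm_comp hflip
  have hfirst : ContDiffAt ℝ ∞ (christoffelFirst G) x := ((hd.add hflip).sub hswap).const_smul _
  have hinv : ContDiffAt ℝ ∞ (fun y ↦ (G y).inverse) x :=
    (hG.isInvertible hx).contDiffAt_map_inverse.comp x (hG.contDiffAt hx)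
  exact (((ContinuousLinearMap.compL ℝ E (E →L[ℝ] ℝ) E).contDiff.contDiffAt).comp x hinv).clm_comp
    hfirst

theorem differentiableAt_christoffel : DifferentiableAt ℝ (christoffel G) x :=
  (hG.contDiffAt_christoffel hx).differentiableAt (by simp)

omit [FiniteDimensional ℝ E] hG hx in
theorem covDeriv_const (u v y : E) : covDeriv G (fun _ ↦ v) y u = christoffel G y u v := by
  simp [covDeriv_apply]

theorem differentiableAt_christoffel_apply (u v : E) :
    DifferentiableAt ℝ (fun y ↦ christoffel G y u v) x :=
  ((hG.differentiableAt_christoffel hx).clm_apply (differentiableAt_const u)).clm_apply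
    (differentiableAt_const v)

theorem fderiv_christoffel_apply (u v w : E) :
    fderiv ℝ (fun y ↦ christoffel G y v w) x u = fderiv ℝ (christoffel G) x u v w := by
  have h := (((hG.differentiableAt_christoffel hx).hasFDerivAt.clm_apply
    (hasFDerivAt_const v x)).clm_apply (hasFDerivAt_const w x)).fderiv
  rw [h]
  simp

/-- The curvature as the commutator of covariant derivatives of constant fields. -/
theorem curvature_eq (u v w : E) :
    curvature G x v w u = covDeriv G (fun y ↦ christoffel G y v w) x u
      - covDeriv G (fun y ↦ christoffel G y u w) x v := by
  rw [covDeriv_apply, covDeriv_apply, hG.fderiv_christoffel_apply hx,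
    hG.fderiv_christoffel_apply hx]
  simp only [curvature, LinearMap.coe_mk, AddHom.coe_mk]
  abel

/-- The second derivative of the function `G (w, z)` is symmetric in `u, v`. Expanding it twice by
metric compatibility, the cross terms are symmetric as well, and what remains is `G (R w, z) + G (w,
R z) = 0`. -/
theorem curvature_skew (u v w z : E) :
    G x (curvature G x v w u) z = -G x w (curvature G x v z u) := by
  have hd : ∀ᶠ y in nhds x, ∀ v, fderiv ℝ (fun y ↦ G y w z) y v =
      G y (christoffel G y v w) z + G y w (christoffel G y v z) := by
    filter_upwards [hG.isOpen.mem_nhds hx] with y hy v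
    rw [hG.fderiv_apply_apply hy (differentiableAt_const w) (differentiableAt_const z),
      covDeriv_const, covDeriv_const]
  have hsmooth : ContDiffAt ℝ 2 (fun y ↦ G y w z) x :=
    (((hG.contDiffAt hx).clm_apply contDiffAt_const).clm_apply contDiffAt_const).of_le (WithTop.coe_le_coe.mpr le_top : ((2 : ℕ∞) : WithTop ℕ∞) ≤ ∞)
  have hdd : DifferentiableAt ℝ (fderiv ℝ fun y ↦ G y w z) x :=
    (hsmooth.fderiv_right (m := 1) (by norm_num)).differentiableAt (by simp)
  have hsecond : ∀ u v, fderiv ℝ (fderiv ℝ fun y ↦ G y w z) x u v =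
      G x (covDeriv G (fun y ↦ christoffel G y v w) x u) z
        + G x (christoffel G x v w) (christoffel G x u z)
        + (G x (christoffel G x u w) (christoffel G x v z)
        + G x w (covDeriv G (fun y ↦ christoffel G y v z) x u)) := by
    intro u v
    have h1 : fderiv ℝ (fun y ↦ fderiv ℝ (fun y ↦ G y w z) y v) x u =
        fderiv ℝ (fderiv ℝ fun y ↦ G y w z) x u v := by
      rw [(hdd.hasFDerivAt.clm_apply (hasFDerivAt_const v x)).fderiv]
      simp
    have h2 : (fun y ↦ fderiv ℝ (fun y ↦ G y w z) y v) =ᶠ[nhds x]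
        fun y ↦ G y (christoffel G y v w) z + G y w (christoffel G y v z) := hd.mono fun y h ↦ h v
    have d1 := hG.differentiableAt_christoffel_apply hx v w
    have d2 := hG.differentiableAt_christoffel_apply hx v z
    have e1 := ((hG.differentiableAt hx).clm_apply d1).clm_apply (differentiableAt_const z)
    have e2 := ((hG.differentiableAt hx).clm_apply (differentiableAt_const w)).clm_apply d2
    rw [← h1, h2.fderiv_eq, fderiv_fun_add e1 e2, add_apply,
      hG.fderiv_apply_apply hx d1 (differentiableAt_const z),
      hG.fderiv_apply_apply hx (differentiableAt_const w) d2, covDeriv_const, covDeriv_const]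
  have hsymm := (hsmooth.isSymmSndFDerivAt (by simp)).eq u v
  rw [hsecond, hsecond] at hsymm
  rw [hG.curvature_eq hx, hG.curvature_eq hx]
  simp only [map_sub, sub_apply]
  linarith

omit hG hx [FiniteDimensional ℝ E] in
theorem curvature_antisymm (u v w : E) : curvature G x v w u = -curvature G x u w v := by
  simp only [curvature, LinearMap.coe_mk, AddHom.coe_mk]
  abel

/-- The Ricci identity. -/
theorem covDeriv_covDeriv_sub {V : E → E} (hV : ContDiffAt ℝ ∞ V x) (u w : E) :
    covDeriv G (fun y ↦ covDeriv G V y w) x u - covDeriv G (fun y ↦ covDeriv G V y u) x w =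
      curvature G x w (V x) u := by
  have hV1 : HasFDerivAt V (fderiv ℝ V x) x := (hV.differentiableAt (by simp)).hasFDerivAt
  have hV2 : DifferentiableAt ℝ (fderiv ℝ V) x :=
    (hV.fderiv_right (m := 1) (by norm_cast)).differentiableAt (by simp)
  have key : ∀ u w, covDeriv G (fun y ↦ covDeriv G V y w) x u =
      fderiv ℝ (fderiv ℝ V) x u w + fderiv ℝ (christoffel G) x u w (V x)
        + christoffel G x w (fderiv ℝ V x u) + christoffel G x u (fderiv ℝ V x w)
        + christoffel G x u (christoffel G x w (V x)) := by
    intro u w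
    have h := (hV2.hasFDerivAt.clm_apply (hasFDerivAt_const w x)).add
      (((hG.differentiableAt_christoffel hx).hasFDerivAt.clm_apply
        (hasFDerivAt_const w x)).clm_apply hV1)
    have h' : fderiv ℝ (fun y ↦ covDeriv G V y w) x = _ := h.fderiv
    rw [covDeriv_apply, h', covDeriv_apply]
    simp
    abel
  -- The second derivative of `V` and the sum of the two mixed terms are symmetric in `u, w`; only
  -- curvature terms survive.
  have hsymm := ((hV.of_le (m := 2) (WithTop.coe_le_coe.mpr le_top : ((2 : ℕ∞) : WithTop ℕ∞) ≤ ∞)).isSymmSndFDerivAt (by simp)).eq u w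
  rw [key, key, hsymm]
  simp only [curvature, LinearMap.coe_mk, AddHom.coe_mk]
  abel

/-- The covariant derivative of a Killing field, given by its equation on constant fields, is skew
for the metric. -/
theorem covDeriv_skew {V : E → E} (u w : E)
    (hK : fderiv ℝ G x (V x) u w + G x (fderiv ℝ V x u) w + G x u (fderiv ℝ V x w) = 0) :
    G x (covDeriv G V x u) w = -G x u (covDeriv G V x w) := by
  -- Absence of torsion turns `Γ(V, u)` into `Γ(u, V)`, which completes `D_u V` to the covariant
  -- derivative.
  rw [hG.fderiv_eq hx, hG.christoffel_symm hx, hG.christoffel_symm hx (V x) w] at hK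
  rw [covDeriv_apply, covDeriv_apply]
  simp only [map_add, add_apply]
  linarith

theorem differentiableAt_covDeriv {V : E → E} (hV : ContDiffAt ℝ ∞ V x) :
    DifferentiableAt ℝ (covDeriv G V) x := by
  have hV2 : DifferentiableAt ℝ (fderiv ℝ V) x :=
    (hV.fderiv_right (m := 1) (by norm_cast)).differentiableAt (by simp)
  refine hV2.add (DifferentiableAt.clm_apply ?_ (hV.differentiableAt (by simp)))
  exact (ContinuousLinearMap.flipₗᵢ ℝ E E E).differentiableAt.comp x
    (hG.differentiableAt_christoffel hx)

/-- For a Killing field `V` of unit length, `g (R(u, V) V, u) = g (∇_u V, ∇_u V)`. -/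
theorem curvature_of_unit_killing {V : E → E} (hV : ContDiffOn ℝ ∞ V U)
    (hK : ∀ y ∈ U, ∀ u w,
      fderiv ℝ G y (V y) u w + G y (fderiv ℝ V y u) w + G y u (fderiv ℝ V y w) = 0)
    (hunit : ∀ y ∈ U, G y (V y) (V y) = 1) :
    (∀ u w, G x (covDeriv G V x u) w = -G x u (covDeriv G V x w)) ∧ covDeriv G V x (V x) = 0 ∧
      ∀ u, G x (curvature G x (V x) (V x) u) u = G x (covDeriv G V x u) (covDeriv G V x u) := by
  have hU := hG.isOpen.mem_nhds hx
  have hVx : ∀ y ∈ U, ContDiffAt ℝ ∞ V y := fun y hy ↦ hV.contDiffAt (hG.isOpen.mem_nhds hy)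
  have hVd : ∀ y ∈ U, DifferentiableAt ℝ V y := fun y hy ↦ (hVx y hy).differentiableAt (by simp)
  have hskew : ∀ y ∈ U, ∀ u w, G y (covDeriv G V y u) w = -G y u (covDeriv G V y w) :=
    fun y hy u w ↦ hG.covDeriv_skew hy u w (hK y hy u w)
  -- Differentiating `G (V, V) = 1` along `u` gives `G (V, ∇_u V) = 0`, and skewness moves the
  -- derivative: `G (∇_V V, u) = 0`.
  have hgeo : ∀ y ∈ U, covDeriv G V y (V y) = 0 := by
    intro y hy
    refine hG.nondegenerate y hy _ fun u ↦ ?_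
    have h1 : (fun z ↦ G z (V z) (V z)) =ᶠ[nhds y] fun _ ↦ 1 := by
      filter_upwards [hG.isOpen.mem_nhds hy] with z hz using hunit z hz
    have h2 := hG.fderiv_apply_apply hy (hVd y hy) (hVd y hy) u
    rw [h1.fderiv_eq, hG.symm y hy (covDeriv G V y u)] at h2
    simp at h2
    rw [hskew y hy]
    linarith
  refine ⟨hskew x hx, hgeo x hx, fun u ↦ ?_⟩
  have hdA := hG.differentiableAt_covDeriv hx (hVx x hx)
  have dA : ∀ w, DifferentiableAt ℝ (fun y ↦ covDeriv G V y w) x := fun w ↦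
    hdA.clm_apply (differentiableAt_const w)
  -- The derivative along `V` of the identity `G (∇_u V, u) = 0`, with `u` constant.
  have h1 : G x (covDeriv G (fun y ↦ covDeriv G V y u) x (V x)) u
      + G x (covDeriv G V x u) (christoffel G x (V x) u) = 0 := by
    rw [← covDeriv_const (G := G) (V x) u, ← hG.fderiv_apply_apply hx (dA u)
      (differentiableAt_const u)]
    have h : (fun y ↦ G y (covDeriv G V y u) u) =ᶠ[nhds x] fun _ ↦ 0 := by
      filter_upwards [hU] with y hy
      have := hskew y hy u u
      rw [hG.symm y hy u] at this
      linarith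
    rw [h.fderiv_eq]
    simp
  -- The derivative along `u` of `∇_V V = 0`. Freezing the direction at `V x` produces the extra
  -- term in `D_u V`.
  have h2 : covDeriv G (fun y ↦ covDeriv G V y (V x)) x u
      + covDeriv G V x (fderiv ℝ V x u) = 0 := by
    have h : (fun y ↦ covDeriv G V y (V y)) =ᶠ[nhds x] fun _ ↦ 0 := by
      filter_upwards [hU] with y hy using hgeo y hy
    have h3 := (hdA.hasFDerivAt.clm_apply (hVd x hx).hasFDerivAt).fderiv
    rw [h.fderiv_eq] at h3
    have h4 := (hdA.hasFDerivAt.clm_apply (hasFDerivAt_const (V x) x)).fderiv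
    rw [covDeriv_apply, h4, hgeo x hx]
    have h5 := congrArg (fun l : E →L[ℝ] E ↦ l u) h3
    simp at h5 ⊢
    rw [add_comm]
    exact h5.symm
  -- By the Ricci identity, `h1`, `h2` and skewness, the curvature term becomes `G (∇_u V, D_u V) +
  -- G (∇_u V, Γ(u, V))`, which is the square of `∇_u V`.
  rw [← hG.covDeriv_covDeriv_sub hx (hVx x hx) u (V x), eq_neg_of_add_eq_zero_left h2]
  simp only [map_sub, map_neg, sub_apply, neg_apply]
  rw [hskew x hx, eq_neg_of_add_eq_zero_left h1, hG.symm x hx (fderiv ℝ V x u),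
    hG.christoffel_symm hx (V x) u]
  have h6 : G x (covDeriv G V x u) (covDeriv G V x u) = G x (covDeriv G V x u) (fderiv ℝ V x u)
      + G x (covDeriv G V x u) (christoffel G x u (V x)) := by
    rw [← map_add]
    rfl
  rw [h6]
  ring

end IsMetricOn

end MetricCoefficients

end MetricCalculus

/-! ### Algebra of indefinite forms and curvature tensors in dimension three -/

section BilinearAlgebra

variable {V : Type*} [AddCommGroup V] [Module ℝ V] {B : V →ₗ[ℝ] V →ₗ[ℝ] ℝ}

/-- A nonzero subspace onto which every linear form `B x` can be projected contains a vector that is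
not null. -/
theorem exists_mem_apply_self_ne_zero (hs : ∀ u v, B u v = B v u)
    (hn : ∀ u, (∀ v, B u v = 0) → u = 0) {K : Submodule ℝ V} (hK : K ≠ ⊥)
    (hproj : ∀ x, ∃ k ∈ K, ∀ z ∈ K, B z x = B z k) : ∃ k ∈ K, B k k ≠ 0 := by
  obtain ⟨e, heK, he⟩ := K.exists_mem_ne_zero_of_ne_bot hK
  by_cases hee : B e e = 0
  -- For null `e`, nondegeneracy and projection give `k` in `K` with `B e k ≠ 0`. If `k` is null
  -- too, `e + k` has square `2 B e k`.
  · obtain ⟨x, hx⟩ : ∃ x, B e x ≠ 0 := by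
      by_contra! h
      exact he (hn e h)
    obtain ⟨k, hkK, hk⟩ := hproj x
    rw [hk e heK] at hx
    by_cases hkk : B k k = 0
    · refine ⟨e + k, K.add_mem heK hkK, ?_⟩
      simp only [map_add, LinearMap.add_apply, hee, hkk, hs k e]
      intro h
      exact hx (by linarith)
    · exact ⟨k, hkK, hkk⟩
  · exact ⟨e, heK, hee⟩

/-- Two linear conditions in dimension three leave a nonzero subspace. As `a` and `b` are not null,
subtracting their components projects onto it. -/
theorem exists_orthogonal_apply_self_ne_zero (hs : ∀ u v, B u v = B v u)
    (hn : ∀ u, (∀ v, B u v = 0) → u = 0) (hdim : Module.finrank ℝ V = 3) {a b : V}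
    (hab : B a b = 0) (ha : B a a ≠ 0) (hb : B b b ≠ 0) :
    ∃ c, B a c = 0 ∧ B b c = 0 ∧ B c c ≠ 0 := by
  have : FiniteDimensional ℝ V := Module.finite_of_finrank_pos (by omega)
  let K : Submodule ℝ V := ((B a).prod (B b)).ker
  have hmem : ∀ x, x ∈ K ↔ B a x = 0 ∧ B b x = 0 := fun x ↦ by simp [K]
  have hK : K ≠ ⊥ := LinearMap.ker_ne_bot_of_finrank_lt (by simp [hdim])
  obtain ⟨c, hc, hcc⟩ := exists_mem_apply_self_ne_zero hs hn hK fun x ↦ by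
    refine ⟨x - (B a x / B a a) • a - (B b x / B b b) • b, ?_, ?_⟩
    · rw [hmem]
      have hba : B b a = 0 := by rw [hs, hab]
      simp [hab, hba, ha, hb]
    · intro z hz
      rw [hmem] at hz
      simp [hs z a, hs z b, hz.1, hz.2]
  exact ⟨c, ((hmem c).mp hc).1, ((hmem c).mp hc).2, hcc⟩

theorem exists_orthogonal_apply_self_ne_zero_of_one (hs : ∀ u v, B u v = B v u)
    (hn : ∀ u, (∀ v, B u v = 0) → u = 0) (hdim : Module.finrank ℝ V = 3) {a : V}
    (ha : B a a ≠ 0) : ∃ c, B a c = 0 ∧ B c c ≠ 0 := by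
  have : FiniteDimensional ℝ V := Module.finite_of_finrank_pos (by omega)
  have hK : (B a).ker ≠ ⊥ := LinearMap.ker_ne_bot_of_finrank_lt (by simp [hdim])
  obtain ⟨c, hc, hcc⟩ := exists_mem_apply_self_ne_zero hs hn hK fun x ↦ by
    refine ⟨x - (B a x / B a a) • a, by simp [ha], fun z hz ↦ ?_⟩
    rw [LinearMap.mem_ker] at hz
    simp [hs z a, hz]
  exact ⟨c, hc, hcc⟩

/-- Three mutually orthogonal vectors, none of them null, form a basis of a three-dimensional
space. -/
theorem exists_basis_of_orthogonal (hs : ∀ u v, B u v = B v u) (hdim : Module.finrank ℝ V = 3)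
    {a b c : V} (hab : B a b = 0) (hac : B a c = 0) (hbc : B b c = 0)
    (ha : B a a ≠ 0) (hb : B b b ≠ 0) (hc : B c c ≠ 0) :
    ∃ e : Module.Basis (Fin 3) ℝ V, ⇑e = ![a, b, c] := by
  have hli : LinearIndependent ℝ ![a, b, c] := by
    refine LinearMap.linearIndependent_of_isOrthoᵢ (B := B) ?_ fun i ↦ by fin_cases i <;> simpa
    rw [LinearMap.isOrthoᵢ_def]
    intro i j hij
    fin_cases i <;> fin_cases j <;> simp_all
  exact ⟨basisOfLinearIndependentOfCardEqFinrank hli (by simp [hdim]), by simp⟩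

/-- The trace of an endomorphism in an orthogonal basis. -/
theorem trace_eq_of_orthogonal (hs : ∀ u v, B u v = B v u) (hdim : Module.finrank ℝ V = 3)
    {a b c : V} (hab : B a b = 0) (hac : B a c = 0) (hbc : B b c = 0)
    (ha : B a a ≠ 0) (hb : B b b ≠ 0) (hc : B c c ≠ 0) (T : V →ₗ[ℝ] V) :
    LinearMap.trace ℝ V T = B (T a) a / B a a + B (T b) b / B b b + B (T c) c / B c c := by
  obtain ⟨e, he⟩ := exists_basis_of_orthogonal hs hdim hab hac hbc ha hb hc
  have hx : ∀ x, x = e.repr x 0 • a + e.repr x 1 • b + e.repr x 2 • c := fun x ↦ by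
    conv_lhs => rw [← e.sum_repr x, Fin.sum_univ_three, he]
    simp
  have h0 : e 0 = a := by simp [he]
  have h1 : e 1 = b := by simp [he]
  have h2 : e 2 = c := by simp [he]
  have hba := (hs b a).trans hab
  have hca := (hs c a).trans hac
  have hcb := (hs c b).trans hbc
  have ra : ∀ x, B x a / B a a = e.repr x 0 := fun x ↦ by
    conv_lhs => rw [hx x]
    simp [hba, hca, ha]
  have rb : ∀ x, B x b / B b b = e.repr x 1 := fun x ↦ by
    conv_lhs => rw [hx x]
    simp [hab, hcb, hb]
  have rc : ∀ x, B x c / B c c = e.repr x 2 := fun x ↦ by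
    conv_lhs => rw [hx x]
    simp [hac, hbc, hc]
  rw [LinearMap.trace_eq_matrix_trace ℝ e, Matrix.trace, Fin.sum_univ_three, ra, rb, rc]
  simp [LinearMap.toMatrix_apply, h0, h1, h2]

theorem eq_zero_of_orthogonal (hs : ∀ u v, B u v = B v u)
    (hn : ∀ u, (∀ v, B u v = 0) → u = 0) (hdim : Module.finrank ℝ V = 3)
    {a b c : V} (hab : B a b = 0) (hac : B a c = 0) (hbc : B b c = 0)
    (ha : B a a ≠ 0) (hb : B b b ≠ 0) (hc : B c c ≠ 0) {x : V}
    (hxa : B x a = 0) (hxb : B x b = 0) (hxc : B x c = 0) : x = 0 := by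
  obtain ⟨e, he⟩ := exists_basis_of_orthogonal hs hdim hab hac hbc ha hb hc
  refine hn x fun v ↦ ?_
  rw [← e.sum_repr v, Fin.sum_univ_three, he]
  simp [hxa, hxb, hxc]

/-- In dimension three, an Einstein curvature tensor `R v w u = R(u, v) w` has constant sectional
curvature: orthogonal case. -/
theorem sectional_eq_of_ricci_eq_of_orthogonal (hs : ∀ u v, B u v = B v u)
    (hn : ∀ u, (∀ v, B u v = 0) → u = 0) (hdim : Module.finrank ℝ V = 3)
    {R : V → V → V →ₗ[ℝ] V} (hanti : ∀ u v w, R v w u = -R u w v)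
    (hskew : ∀ u v w z, B (R v w u) z = -B w (R v z u)) {l : ℝ}
    (hric : ∀ v w, LinearMap.trace ℝ V (R v w) = l * B v w) {u v : V} (huv : B u v = 0)
    (hu : B u u ≠ 0) (hv : B v v ≠ 0) : B (R v v u) u = l / 2 * (B u u * B v v) := by
  obtain ⟨w, huw, hvw, hw⟩ := exists_orthogonal_apply_self_ne_zero hs hn hdim huv hu hv
  have hself : ∀ v, R v v v = 0 := fun v ↦ by
    have h : (2 : ℝ) • R v v v = 0 := by
      rw [two_smul]
      nth_rewrite 1 [hanti]
      simp
    simpa using h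
  have hpair : ∀ a b, B (R b b a) a = B (R a a b) b := fun a b ↦ by
    rw [hskew, hanti, map_neg, neg_neg, hs]
  have ht := trace_eq_of_orthogonal hs hdim huv huw hvw hu hv hw
  have h1 := hric u u
  have h2 := hric v v
  have h3 := hric w w
  rw [ht] at h1 h2 h3
  rw [hself] at h1 h2 h3
  rw [hpair v u, hpair w u] at h1
  rw [hpair w v] at h2
  simp only [map_zero, LinearMap.zero_apply, zero_div, zero_add, add_zero] at h1 h2 h3
  rw [div_add_div _ _ hv hw, div_eq_iff (mul_ne_zero hv hw)] at h1
  rw [div_add_div _ _ hu hw, div_eq_iff (mul_ne_zero hu hw)] at h2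
  rw [div_add_div _ _ hu hv, div_eq_iff (mul_ne_zero hu hv)] at h3
  -- The cleared equations are linear in the three curvature numerators; `h1 + h2 - h3` isolates
  -- twice that of the plane `u, v`, multiplied by `B w w`.
  refine mul_right_cancel₀ hw ?_
  linarith

/-- In dimension three, an Einstein curvature tensor `R v w u = R(u, v) w` has constant sectional
curvature. -/
theorem sectional_eq_of_ricci_eq (hs : ∀ u v, B u v = B v u)
    (hn : ∀ u, (∀ v, B u v = 0) → u = 0) (hdim : Module.finrank ℝ V = 3)
    {R : V → V → V →ₗ[ℝ] V} (hanti : ∀ u v w, R v w u = -R u w v)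
    (hskew : ∀ u v w z, B (R v w u) z = -B w (R v z u)) {l : ℝ}
    (hric : ∀ v w, LinearMap.trace ℝ V (R v w) = l * B v w) {u v : V}
    (huv : B u u * B v v - B u v ^ 2 ≠ 0) :
    B (R v v u) u = l / 2 * (B u u * B v v - B u v ^ 2) := by
  have hself : ∀ v w, R v w v = 0 := fun v w ↦ by
    have h : (2 : ℝ) • R v w v = 0 := by
      rw [two_smul]
      nth_rewrite 1 [hanti]
      simp
    simpa using h
  have hself' : ∀ u v w, B (R v w u) w = 0 := fun u v w ↦ by
    have := hskew u v w w
    rw [hs w] at this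
    linarith
  have hpair : ∀ a b, B (R b b a) a = B (R a a b) b := fun a b ↦ by
    rw [hskew, hanti, map_neg, neg_neg, hs]
  -- The curvature numerator and the Gram determinant are both invariant under the shear `v ↦ v + t
  -- u`, so Gram–Schmidt reduces to the orthogonal case once `u` is not null.
  have hshift : ∀ (u v : V) (t : ℝ), B (R (v + t • u) (v + t • u) u) u = B (R v v u) u := by
    intro u v t
    have h : R (v + t • u) (v + t • u) u = R v (v + t • u) u := by
      rw [hanti, map_add, map_smul, hself, smul_zero, add_zero, ← hanti]
    rw [h, hskew, map_add, map_smul, LinearMap.add_apply, LinearMap.smul_apply, hs u, hself',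
      smul_zero, add_zero, ← hskew]
  have hgram : ∀ (u v : V) (t : ℝ), B u u * B (v + t • u) (v + t • u) - B u (v + t • u) ^ 2 =
      B u u * B v v - B u v ^ 2 := fun u v t ↦ by
    simp [hs v u]
    ring
  have hone : ∀ u v, B u u * B v v - B u v ^ 2 ≠ 0 → B u u ≠ 0 →
      B (R v v u) u = l / 2 * (B u u * B v v - B u v ^ 2) := by
    intro u v huv hu
    have h0 : B u (v + (-(B u v / B u u)) • u) = 0 := by simp [hu]
    rw [← hshift u v (-(B u v / B u u)), ← hgram u v (-(B u v / B u u))] 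
    rw [← hgram u v (-(B u v / B u u))] at huv
    rw [h0] at huv ⊢
    rw [sectional_eq_of_ricci_eq_of_orthogonal hs hn hdim hanti hskew hric h0 hu]
    · ring
    · intro h
      exact huv (by rw [h]; ring)
  by_cases hu : B u u = 0
  · by_cases hv : B v v = 0
    -- When both vectors are null, `u + v` has square `2 B u v ≠ 0` and spans the same plane with
    -- `v`.
    · have h0 : B u v ≠ 0 := by
        intro h
        simp [hu, h] at huv
      have h1 : B (u + (1 : ℝ) • v) (u + (1 : ℝ) • v) ≠ 0 := by
        simpa [hu, hv, hs v u, ← two_mul] using h0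
      have hg' : B (u + (1 : ℝ) • v) (u + (1 : ℝ) • v) * B v v - B (u + (1 : ℝ) • v) v ^ 2 =
          B u u * B v v - B u v ^ 2 := by
        rw [hs (u + (1 : ℝ) • v) v, mul_comm, hgram v u 1, hs v u]
        ring
      have h := hone (u + (1 : ℝ) • v) v (by
        rw [hg']
        exact huv) h1
      rw [hpair, hshift, hpair] at h
      rw [h, hg']
    · rw [hpair, hone v u (by rw [hs v u]; contrapose! huv; linarith) hv, hs v u]
      ring
  · exact hone u v huv hu

/-- In dimension three, a skew map `A` that kills `x` sends a vector `u` orthogonal to `x` to a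
multiple of the third vector `v` of an orthogonal basis. If `v` has the opposite square of `u`, then
the square of `A u` is a nonpositive multiple of that of `u`. -/
theorem apply_self_of_skew (hs : ∀ u v, B u v = B v u)
    (hn : ∀ u, (∀ v, B u v = 0) → u = 0) (hdim : Module.finrank ℝ V = 3)
    {A : V → V} (hA : ∀ u w, B (A u) w = -B u (A w)) {u v x : V} (hx : B x x ≠ 0) (hAx : A x = 0)
    (hu : B u u ≠ 0) (hv : B v v = -B u u) (huv : B u v = 0) (hux : B u x = 0) (hvx : B v x = 0) :
    ∃ t : ℝ, B (A u) (A u) = -t ^ 2 * B u u := by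
  have hv0 : B v v ≠ 0 := by rw [hv]; exact neg_ne_zero.mpr hu
  have hAu : B (A u) u = 0 := by
    have := hA u u
    rw [hs u] at this
    linarith
  have hAux : B (A u) x = 0 := by rw [hA, hAx]; simp
  -- `A u` is orthogonal to `u` and to `x`, so removing its `v`-component leaves a vector orthogonal
  -- to a basis.
  have h : A u - (B (A u) v / B v v) • v = 0 :=
    eq_zero_of_orthogonal hs hn hdim huv hux hvx hu hv0 hx (by simp [hAu, hs v u, huv])
      (by simp [hv0]) (by simp [hAux, hvx])
  refine ⟨B (A u) v / B v v, ?_⟩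
  rw [sub_eq_zero] at h
  generalize B (A u) v / B v v = t at h
  rw [h]
  simp [hv]
  ring

end BilinearAlgebra

/-! ### Vector fields in a chart -/

section ChartTransfer

open Set VectorField

variable {E : Type*} [NormedAddCommGroup E] [NormedSpace ℝ E] [FiniteDimensional ℝ E]
  {M : Type*} [TopologicalSpace M] [ChartedSpace E M]

section

variable [IsManifold 𝓘(ℝ, E) ∞ M]

omit [FiniteDimensional ℝ E] in
theorem isInvertible_mfderiv_extChartAt_symm {p : M} {x : E}
    (hx : x ∈ (extChartAt 𝓘(ℝ, E) p).target) :
    (mfderiv 𝓘(ℝ, E) 𝓘(ℝ, E) (extChartAt 𝓘(ℝ, E) p).symm x).IsInvertible := by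
  have h := isInvertible_mfderivWithin_extChartAt_symm (I := 𝓘(ℝ, E)) hx
  rwa [modelWithCornersSelf_coe, range_id, mfderivWithin_univ] at h

omit [FiniteDimensional ℝ E] in
theorem contMDiffAt_extChartAt_symm {p : M} {x : E} (hx : x ∈ (extChartAt 𝓘(ℝ, E) p).target) :
    ContMDiffAt 𝓘(ℝ, E) 𝓘(ℝ, E) ∞ (extChartAt 𝓘(ℝ, E) p).symm x :=
  (contMDiffOn_extChartAt_symm p).contMDiffAt ((isOpen_extChartAt_target p).mem_nhds hx)

/-- The representation of a vector field in the chart at `p`. -/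
noncomputable def chartPullback (p : M) (V : ∀ q : M, TangentSpace 𝓘(ℝ, E) q) : E → E :=
  mpullback 𝓘(ℝ, E) 𝓘(ℝ, E) (extChartAt 𝓘(ℝ, E) p).symm V

theorem contDiffOn_chartPullback (p : M) {V : ∀ q : M, TangentSpace 𝓘(ℝ, E) q}
    (hV : IsSmoothVectorField V) :
    ContDiffOn ℝ ∞ (chartPullback p V) (extChartAt 𝓘(ℝ, E) p).target := by
  have : CompleteSpace E := FiniteDimensional.complete ℝ E
  intro x hx
  refine ContDiffAt.contDiffWithinAt ?_
  have h := ContMDiffAt.mpullback_vectorField_preimage (m := ∞) (V := V) (hV _)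
    (contMDiffAt_extChartAt_symm hx) (isInvertible_mfderiv_extChartAt_symm hx) (by simp)
  exact contMDiffAt_vectorSpace_iff_contDiffAt.mp h

omit [FiniteDimensional ℝ E] in
theorem mfderiv_chartPullback {p : M} {x : E} (hx : x ∈ (extChartAt 𝓘(ℝ, E) p).target)
    (V : ∀ q : M, TangentSpace 𝓘(ℝ, E) q) :
    mfderiv 𝓘(ℝ, E) 𝓘(ℝ, E) (extChartAt 𝓘(ℝ, E) p).symm x (chartPullback p V x : E) =
      V ((extChartAt 𝓘(ℝ, E) p).symm x) := by
  have h := (isInvertible_mfderiv_extChartAt_symm hx).self_apply_inverse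
    (V ((extChartAt 𝓘(ℝ, E) p).symm x))
  exact h

omit [FiniteDimensional ℝ E] in
theorem mfderiv_extChartAt_mfderiv_symm {p : M} {x : E}
    (hx : x ∈ (extChartAt 𝓘(ℝ, E) p).target) (u : E) :
    mfderiv 𝓘(ℝ, E) 𝓘(ℝ, E) (extChartAt 𝓘(ℝ, E) p) ((extChartAt 𝓘(ℝ, E) p).symm x)
      (mfderiv 𝓘(ℝ, E) 𝓘(ℝ, E) (extChartAt 𝓘(ℝ, E) p).symm x u) = u := by
  have h := mfderiv_extChartAt_comp_mfderivWithin_extChartAt_symm (I := 𝓘(ℝ, E)) hx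
  rw [modelWithCornersSelf_coe, range_id, mfderivWithin_univ] at h
  exact congrArg (fun l : E →L[ℝ] E ↦ l u) h

theorem chartPullback_mlieBracket {p : M} {x : E} (hx : x ∈ (extChartAt 𝓘(ℝ, E) p).target)
    {V W : ∀ q : M, TangentSpace 𝓘(ℝ, E) q} (hV : IsSmoothVectorField V)
    (hW : IsSmoothVectorField W) :
    chartPullback p (mlieBracket 𝓘(ℝ, E) V W) x =
      lieBracket ℝ (chartPullback p V) (chartPullback p W) x := by
  have : CompleteSpace E := FiniteDimensional.complete ℝ E
  have : IsManifold 𝓘(ℝ, E) (minSmoothness ℝ 2) M := by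
    rw [minSmoothness_of_isRCLikeNormedField]
    infer_instance
  have h := mpullback_mlieBracket (I := 𝓘(ℝ, E)) ((hV _).mdifferentiableAt (by simp))
    ((hW _).mdifferentiableAt (by simp)) (contMDiffAt_extChartAt_symm hx)
    (by rw [minSmoothness_of_isRCLikeNormedField]
        exact (WithTop.coe_le_coe.mpr le_top : ((2 : ℕ∞) : WithTop ℕ∞) ≤ ∞))
  rw [← mlieBracketWithin_univ (I := 𝓘(ℝ, E)) (M := E), mlieBracketWithin_eq_lieBracketWithin] at h
  rw [← lieBracketWithin_univ]
  exact h

/-- The Lie derivative conditions are tested on global fields, while the local calculus uses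
constant ones. A constant field in the chart, cut off by a bump function, serves both; `U` is where
the bump is `1`, the same for every `u`. -/
theorem exists_smoothVectorField_chartPullback_eq [T2Space M] (p : M) :
    ∃ U : Set E, IsOpen U ∧ extChartAt 𝓘(ℝ, E) p p ∈ U ∧ U ⊆ (extChartAt 𝓘(ℝ, E) p).target ∧
      ∀ u : E, ∃ X : ∀ q : M, TangentSpace 𝓘(ℝ, E) q, IsSmoothVectorField X ∧
        ∀ x ∈ U, chartPullback p X x = u := by
  have : CompleteSpace E := FiniteDimensional.complete ℝ E
  let f : SmoothBumpFunction 𝓘(ℝ, E) p := Classical.arbitrary _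
  have h1 : ∀ᶠ x in nhds (extChartAt 𝓘(ℝ, E) p p), f ((extChartAt 𝓘(ℝ, E) p).symm x) = 1 := by
    have hc : Filter.Tendsto (extChartAt 𝓘(ℝ, E) p).symm (nhds (extChartAt 𝓘(ℝ, E) p p))
        (nhds p) := by
      have := (continuousAt_extChartAt_symm (I := 𝓘(ℝ, E)) p).tendsto
      rwa [extChartAt_to_inv] at this
    exact hc.eventually f.eventuallyEq_one
  obtain ⟨W, hW, hWo, hpW⟩ := eventually_nhds_iff.mp h1
  refine ⟨W ∩ (extChartAt 𝓘(ℝ, E) p).target, hWo.inter (isOpen_extChartAt_target p),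
    ⟨hpW, mem_extChartAt_target p⟩, inter_subset_right, fun u ↦ ?_⟩
  let X : ∀ q : M, TangentSpace 𝓘(ℝ, E) q :=
    mpullback 𝓘(ℝ, E) 𝓘(ℝ, E) (extChartAt 𝓘(ℝ, E) p) fun _ ↦ u
  refine ⟨fun q ↦ f q • X q, ?_, fun x hx ↦ ?_⟩
  · have hX : ContMDiffOn 𝓘(ℝ, E) 𝓘(ℝ, E).tangent ∞
        (fun q ↦ (⟨q, X q⟩ : TangentBundle 𝓘(ℝ, E) M)) (chartAt E p).source := by
      intro q hq
      refine ContMDiffAt.contMDiffWithinAt ?_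
      refine ContMDiffAt.mpullback_vectorField_preimage (n := ∞) ?_ (contMDiffAt_extChartAt' hq)
        (isInvertible_mfderiv_extChartAt (by rwa [extChartAt_source])) (by simp)
      exact contMDiffAt_vectorSpace_iff_contDiffAt.mpr contDiffAt_const
    exact ContMDiffOn.smul_section_of_tsupport (f.contMDiff.contMDiffOn)
      (chartAt E p).open_source f.tsupport_subset_chartAt_source hX
  · have hinv := isInvertible_mfderiv_extChartAt_symm hx.2
    refine hinv.injective ((mfderiv_chartPullback hx.2 _).trans ?_)
    refine (isInvertible_mfderiv_extChartAt (I := 𝓘(ℝ, E))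
      ((extChartAt 𝓘(ℝ, E) p).map_target hx.2)).injective ?_
    refine Eq.trans ?_ (mfderiv_extChartAt_mfderiv_symm hx.2 u).symm
    rw [hW x hx.1, one_smul]
    exact (isInvertible_mfderiv_extChartAt (I := 𝓘(ℝ, E))
      ((extChartAt 𝓘(ℝ, E) p).map_target hx.2)).self_apply_inverse u

end

end ChartTransfer

/-! ### The metric, the Killing equation and the curvature in a chart -/

section MetricTransfer

open Set VectorField MetricCoefficients

variable {E : Type*} [NormedAddCommGroup E] [NormedSpace ℝ E] [FiniteDimensional ℝ E]
  {M : Type*} [TopologicalSpace M] [ChartedSpace E M] [IsManifold 𝓘(ℝ, E) ∞ M]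

namespace PseudoRiemannianMetric

variable (g : PseudoRiemannianMetric E M)

omit [FiniteDimensional ℝ E] in
theorem inChart_apply (p : M) (x u v : E) :
    g.inChart p x u v = g.form ((extChartAt 𝓘(ℝ, E) p).symm x)
      (mfderiv 𝓘(ℝ, E) 𝓘(ℝ, E) (extChartAt 𝓘(ℝ, E) p).symm x u)
      (mfderiv 𝓘(ℝ, E) 𝓘(ℝ, E) (extChartAt 𝓘(ℝ, E) p).symm x v) := rfl

omit [FiniteDimensional ℝ E] in
theorem inChart_chartPullback {p : M} {x : E} (hx : x ∈ (extChartAt 𝓘(ℝ, E) p).target)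
    (V W : ∀ q : M, TangentSpace 𝓘(ℝ, E) q) :
    g.inChart p x (chartPullback p V x) (chartPullback p W x) =
      g.form ((extChartAt 𝓘(ℝ, E) p).symm x) (V ((extChartAt 𝓘(ℝ, E) p).symm x))
        (W ((extChartAt 𝓘(ℝ, E) p).symm x)) := by
  rw [inChart_apply, mfderiv_chartPullback hx, mfderiv_chartPullback hx]

omit [FiniteDimensional ℝ E] in
theorem contMDiff_form_apply {X Y : ∀ q : M, TangentSpace 𝓘(ℝ, E) q}
    (hX : IsSmoothVectorField X) (hY : IsSmoothVectorField Y) :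
    ContMDiff 𝓘(ℝ, E) 𝓘(ℝ, ℝ) ∞ fun q ↦ g.form q (X q) (Y q) := by
  have h : ContMDiff 𝓘(ℝ, E) (𝓘(ℝ, E).prod 𝓘(ℝ, ℝ)) ∞
      (fun q ↦ Bundle.TotalSpace.mk' ℝ (E := Bundle.Trivial M ℝ) q (g.form q (X q) (Y q))) :=
    ContMDiff.clm_bundle_apply₂ (F₁ := E) (F₂ := E) (F₃ := ℝ) g.smooth hX hY
  exact fun q ↦ (Bundle.contMDiffAt_totalSpace.mp (h q)).2

/-- On fields constant in the chart, the coefficients are the smooth functions `g (X, Y)`;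
nondegeneracy passes through the invertible derivative of the chart. -/
theorem isMetricOn_inChart {p : M} {U : Set E} (hU : IsOpen U)
    (hUt : U ⊆ (extChartAt 𝓘(ℝ, E) p).target)
    (hX : ∀ u : E, ∃ X : ∀ q : M, TangentSpace 𝓘(ℝ, E) q, IsSmoothVectorField X ∧
        ∀ x ∈ U, chartPullback p X x = u) : IsMetricOn (g.inChart p) U where
  isOpen := hU
  contDiffOn := by
    rw [contDiffOn_clm_apply]
    intro u
    rw [contDiffOn_clm_apply]
    intro v
    obtain ⟨X, hXs, hX'⟩ := hX u
    obtain ⟨Y, hYs, hY'⟩ := hX v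
    have h : ContDiffOn ℝ ∞ ((fun q ↦ g.form q (X q) (Y q)) ∘ (extChartAt 𝓘(ℝ, E) p).symm) U := by
      intro x hx
      refine ContDiffAt.contDiffWithinAt (contMDiffAt_iff_contDiffAt.mp ?_)
      exact ((g.contMDiff_form_apply hXs hYs) _).comp x (contMDiffAt_extChartAt_symm (hUt hx))
    refine h.congr fun x hx ↦ ?_
    rw [Function.comp_apply, ← g.inChart_chartPullback (hUt hx), hX' x hx, hY' x hx]
  symm x hx u v := g.symm _ _ _
  nondegenerate x hx u h := by
    have hinv := isInvertible_mfderiv_extChartAt_symm (hUt hx)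
    refine hinv.injective ((g.nondegenerate _ _ fun v ↦ ?_).trans (map_zero _).symm)
    obtain ⟨w, rfl⟩ := hinv.surjective v
    exact h w

theorem lieDeriv_extChartAt_symm {p : M} {x : E} (hx : x ∈ (extChartAt 𝓘(ℝ, E) p).target)
    {V X Y : ∀ q : M, TangentSpace 𝓘(ℝ, E) q} (hV : IsSmoothVectorField V)
    (hX : IsSmoothVectorField X) (hY : IsSmoothVectorField Y) :
    g.lieDeriv V X Y ((extChartAt 𝓘(ℝ, E) p).symm x) =
      fderiv ℝ (fun y ↦ g.inChart p y (chartPullback p X y) (chartPullback p Y y)) x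
          (chartPullback p V x)
        - g.inChart p x (lieBracket ℝ (chartPullback p V) (chartPullback p X) x)
          (chartPullback p Y x)
        - g.inChart p x (chartPullback p X x)
          (lieBracket ℝ (chartPullback p V) (chartPullback p Y) x) := by
  rw [← chartPullback_mlieBracket hx hV hX, ← chartPullback_mlieBracket hx hV hY,
    inChart_chartPullback g hx, inChart_chartPullback g hx, lieDeriv]
  congr 2
  have h : (fun y ↦ g.inChart p y (chartPullback p X y) (chartPullback p Y y)) =ᶠ[nhds x]
      (fun q ↦ g.form q (X q) (Y q)) ∘ (extChartAt 𝓘(ℝ, E) p).symm := by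
    filter_upwards [(isOpen_extChartAt_target p).mem_nhds hx] with y hy
      using g.inChart_chartPullback hy X Y
  rw [h.fderiv_eq, ← mfderiv_eq_fderiv, mfderiv_comp x
    ((g.contMDiff_form_apply hX hY _).mdifferentiableAt (by simp))
    ((contMDiffAt_extChartAt_symm hx).mdifferentiableAt (by simp)), ← mfderiv_chartPullback hx V]
  rfl

/-- The Killing equation in a chart. -/
theorem killing_inChart {p : M} {U : Set E} (hU : IsOpen U)
    (hUt : U ⊆ (extChartAt 𝓘(ℝ, E) p).target)
    (hX : ∀ u : E, ∃ X : ∀ q : M, TangentSpace 𝓘(ℝ, E) q, IsSmoothVectorField X ∧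
        ∀ x ∈ U, chartPullback p X x = u) {V : ∀ q : M, TangentSpace 𝓘(ℝ, E) q}
    (hV : IsSmoothVectorField V) (hK : g.IsKilling V) {x : E} (hx : x ∈ U) (u w : E) :
    fderiv ℝ (g.inChart p) x (chartPullback p V x) u w
      + g.inChart p x (fderiv ℝ (chartPullback p V) x u) w
      + g.inChart p x u (fderiv ℝ (chartPullback p V) x w) = 0 := by
  obtain ⟨X, hXs, hX'⟩ := hX u
  obtain ⟨Y, hYs, hY'⟩ := hX w
  have hm := g.isMetricOn_inChart hU hUt hX
  have h := hK X Y hXs hYs ((extChartAt 𝓘(ℝ, E) p).symm x)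
  have hXe : chartPullback p X =ᶠ[nhds x] fun _ ↦ u := by
    filter_upwards [hU.mem_nhds hx] using hX'
  have hYe : chartPullback p Y =ᶠ[nhds x] fun _ ↦ w := by
    filter_upwards [hU.mem_nhds hx] using hY'
  have he : (fun y ↦ g.inChart p y (chartPullback p X y) (chartPullback p Y y)) =ᶠ[nhds x]
      fun y ↦ g.inChart p y u w := by
    filter_upwards [hXe, hYe] with y h1 h2
    rw [h1, h2]
  -- For a constant field `u` the bracket `[V, u]` is `-D_u V`, whence the plus signs.
  rw [g.lieDeriv_extChartAt_symm (hUt hx) hV hXs hYs, he.fderiv_eq,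
    fderiv_bilin_apply (hm.differentiableAt hx) (differentiableAt_const u)
      (differentiableAt_const w), hXe.eq_of_nhds, hYe.eq_of_nhds, lieBracket, lieBracket,
    hXe.fderiv_eq, hYe.fderiv_eq, hX' x hx, hY' x hx] at h
  simp at h
  linarith

/-- The derivative of the chart at `p`. -/
noncomputable def chartDeriv (p : M) : TangentSpace 𝓘(ℝ, E) p →L[ℝ] E :=
  mfderiv 𝓘(ℝ, E) 𝓘(ℝ, E) (extChartAt 𝓘(ℝ, E) p) p

omit [FiniteDimensional ℝ E] in
theorem isInvertible_chartDeriv (p : M) : (chartDeriv (E := E) p).IsInvertible :=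
  isInvertible_mfderiv_extChartAt (I := 𝓘(ℝ, E)) (mem_extChartAt_source p)

omit [FiniteDimensional ℝ E] in
theorem curvature_apply (p : M) (u v w : TangentSpace 𝓘(ℝ, E) p) :
    chartDeriv p (g.curvature p v w u) = MetricCoefficients.curvature (g.inChart p)
      (extChartAt 𝓘(ℝ, E) p p) (chartDeriv p v) (chartDeriv p w) (chartDeriv p u) :=
  (isInvertible_chartDeriv p).self_apply_inverse _

omit [FiniteDimensional ℝ E] in
theorem chartDeriv_apply (p : M) (V : ∀ q : M, TangentSpace 𝓘(ℝ, E) q) :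
    chartDeriv p (V p) = chartPullback p V (extChartAt 𝓘(ℝ, E) p p) := by
  have hx := mem_extChartAt_target (I := 𝓘(ℝ, E)) p
  have h := mfderiv_extChartAt_mfderiv_symm hx (chartPullback p V (extChartAt 𝓘(ℝ, E) p p))
  rw [mfderiv_chartPullback hx, extChartAt_to_inv] at h
  exact h

/-- This allows equations stated for global fields, such as the soliton equation, to be read on
single tangent vectors. -/
theorem exists_smoothVectorField_eq [T2Space M] (p : M) (u : TangentSpace 𝓘(ℝ, E) p) :
    ∃ X : ∀ q : M, TangentSpace 𝓘(ℝ, E) q, IsSmoothVectorField X ∧ X p = u := by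
  obtain ⟨U, -, hpU, -, hX⟩ := exists_smoothVectorField_chartPullback_eq (E := E) p
  obtain ⟨X, hXs, hX⟩ := hX (chartDeriv p u)
  refine ⟨X, hXs, (isInvertible_chartDeriv p).injective ?_⟩
  rw [chartDeriv_apply, hX _ hpU]

theorem inChart_chartDeriv [T2Space M] (p : M) (u v : TangentSpace 𝓘(ℝ, E) p) :
    g.inChart p (extChartAt 𝓘(ℝ, E) p p) (chartDeriv p u) (chartDeriv p v) = g.form p u v := by
  obtain ⟨X, -, rfl⟩ := exists_smoothVectorField_eq p u
  obtain ⟨Y, -, rfl⟩ := exists_smoothVectorField_eq p v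
  rw [chartDeriv_apply, chartDeriv_apply, g.inChart_chartPullback (mem_extChartAt_target p),
    extChartAt_to_inv]

omit [FiniteDimensional ℝ E] in
theorem curvature_antisymm (p : M) (u v w : TangentSpace 𝓘(ℝ, E) p) :
    g.curvature p v w u = -g.curvature p u w v := by
  apply (isInvertible_chartDeriv p).injective
  rw [map_neg, curvature_apply, curvature_apply, MetricCoefficients.IsMetricOn.curvature_antisymm]

theorem curvature_skew [T2Space M] (p : M) (u v w z : TangentSpace 𝓘(ℝ, E) p) :
    g.form p (g.curvature p v w u) z = -g.form p w (g.curvature p v z u) := by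
  obtain ⟨U, hU, hpU, hUt, hX⟩ := exists_smoothVectorField_chartPullback_eq (E := E) p
  rw [← inChart_chartDeriv, ← inChart_chartDeriv, curvature_apply, curvature_apply,
    (g.isMetricOn_inChart hU hUt hX).curvature_skew hpU]

/-- At each point, a unit Killing field has a covariant derivative `A`, which determines the
curvature of the planes that contain the field. -/
theorem exists_skew_of_unit_killing [T2Space M] {V : ∀ q : M, TangentSpace 𝓘(ℝ, E) q}
    (hV : IsSmoothVectorField V) (hK : g.IsKilling V) (hunit : ∀ q, g.form q (V q) (V q) = 1)
    (p : M) : ∃ A : TangentSpace 𝓘(ℝ, E) p → TangentSpace 𝓘(ℝ, E) p,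
      (∀ u w, g.form p (A u) w = -g.form p u (A w)) ∧ A (V p) = 0 ∧
      ∀ u, g.form p (g.curvature p (V p) (V p) u) u = g.form p (A u) (A u) := by
  obtain ⟨U, hU, hpU, hUt, hX⟩ := exists_smoothVectorField_chartPullback_eq (E := E) p
  obtain ⟨h1, h2, h3⟩ := (g.isMetricOn_inChart hU hUt hX).curvature_of_unit_killing hpU
    ((contDiffOn_chartPullback p hV).mono hUt)
    (fun y hy u w ↦ g.killing_inChart hU hUt hX hV hK hy u w)
    (fun y hy ↦ by rw [g.inChart_chartPullback (hUt hy), hunit])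
  let A : TangentSpace 𝓘(ℝ, E) p → TangentSpace 𝓘(ℝ, E) p := fun u ↦ (chartDeriv p).inverse
    (covDeriv (g.inChart p) (chartPullback p V) (extChartAt 𝓘(ℝ, E) p p) (chartDeriv p u))
  have hA : ∀ u, chartDeriv p (A u) =
      covDeriv (g.inChart p) (chartPullback p V) (extChartAt 𝓘(ℝ, E) p p) (chartDeriv p u) :=
    fun u ↦ (isInvertible_chartDeriv p).self_apply_inverse _
  refine ⟨A, fun u w ↦ ?_, ?_, fun u ↦ ?_⟩
  · rw [← inChart_chartDeriv, ← inChart_chartDeriv, hA, hA, h1]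
  · apply (isInvertible_chartDeriv p).injective
    rw [hA, chartDeriv_apply, h2, map_zero]
  · rw [← inChart_chartDeriv, ← inChart_chartDeriv, hA, curvature_apply, chartDeriv_apply, h3]

end PseudoRiemannianMetric

end MetricTransfer

/-! ### Paracontact identities and the main theorem -/

namespace AlmostParacontactMetricStructure

variable {E : Type*} [NormedAddCommGroup E] [NormedSpace ℝ E] [FiniteDimensional ℝ E]
  {M : Type*} [TopologicalSpace M] [ChartedSpace E M] [IsManifold 𝓘(ℝ, E) ∞ M]
  (S : AlmostParacontactMetricStructure E M)

omit [FiniteDimensional ℝ E] in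
theorem form_ξ (p : M) (u : TangentSpace 𝓘(ℝ, E) p) : S.g.form p u (S.ξ p) = S.η p u := by
  have h := S.compatible p u (S.ξ p)
  rw [S.φ_ξ, S.η_ξ, map_zero] at h
  linarith

omit [FiniteDimensional ℝ E] in
theorem form_ξ_ξ (p : M) : S.g.form p (S.ξ p) (S.ξ p) = 1 := by rw [form_ξ, η_ξ]

omit [FiniteDimensional ℝ E] in
-- Compatibility for `u` and `φ v`, with `φ² = Id - η ⊗ ξ` and `η ∘ φ = 0`. In particular `φ u` is
-- orthogonal to `u`.
theorem form_φ_skew (p : M) (u v : TangentSpace 𝓘(ℝ, E) p) :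
    S.g.form p (S.φ p u) v = -S.g.form p u (S.φ p v) := by
  have h := S.compatible p u (S.φ p v)
  rw [S.φ_sq, S.η_φ, map_sub, map_smul, form_ξ, S.η_φ] at h
  simp at h
  exact h

omit [FiniteDimensional ℝ E] in
/-- A conformal Killing Reeb field is Killing. -/
theorem isKilling_of_isConformalKilling (h : S.g.IsConformalKilling S.ξ) :
    S.g.IsKilling S.ξ := by
  obtain ⟨f, -, hf⟩ := h
  have hf0 : ∀ p, f p = 0 := fun p ↦ by
    have h := hf S.ξ S.ξ S.smooth_ξ S.smooth_ξ p
    have h1 : (fun q ↦ S.g.form q (S.ξ q) (S.ξ q)) = fun _ ↦ 1 := funext S.form_ξ_ξ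
    rw [PseudoRiemannianMetric.lieDeriv, h1, VectorField.mlieBracket_self, form_ξ_ξ, mul_one] at h
    rw [← h]
    simp [mvfderiv_const]
  intro X Y hX hY p
  rw [hf X Y hX hY, hf0, zero_mul]

theorem ricci_of_killing_soliton [T2Space M] (hK : S.g.IsKilling S.ξ) {c : ℝ}
    (hc : ∀ X Y, IsSmoothVectorField X → IsSmoothVectorField Y →
      ∀ p, S.g.lieDeriv S.ξ X Y p + S.g.ricci p (X p) (Y p) = c * S.g.form p (X p) (Y p))
    (p : M) (u v : TangentSpace 𝓘(ℝ, E) p) : S.g.ricci p u v = c * S.g.form p u v := by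
  obtain ⟨X, hX, rfl⟩ := PseudoRiemannianMetric.exists_smoothVectorField_eq p u
  obtain ⟨Y, hY, rfl⟩ := PseudoRiemannianMetric.exists_smoothVectorField_eq p v
  rw [← hc X Y hX hY, hK X Y hX hY, zero_add]

end AlmostParacontactMetricStructure

theorem mainTheorem6 {M : Type*} [TopologicalSpace M] [T2Space M] [SecondCountableTopology M]
    [ConnectedSpace M] [ChartedSpace (EuclideanSpace ℝ (Fin 3)) M]
    [IsManifold 𝓘(ℝ, EuclideanSpace ℝ (Fin 3)) ∞ M]
    (S : AlmostParacontactMetricStructure (EuclideanSpace ℝ (Fin 3)) M)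
    (hnormal : S.IsNormal) (hconf : S.g.IsConformalKilling S.ξ) :
    S.g.IsKilling S.ξ ∧
      (S.g.IsRicciSoliton S.ξ →
        S.g.IsEinstein ∧ ∃ k : ℝ, k ≤ 0 ∧ S.g.HasConstantSectionalCurvature k) := by
  have hK := S.isKilling_of_isConformalKilling hconf
  refine ⟨hK, fun ⟨c, hc⟩ ↦ ?_⟩
  have hric := S.ricci_of_killing_soliton hK hc
  have hdim : ∀ p : M,
      Module.finrank ℝ (TangentSpace 𝓘(ℝ, EuclideanSpace ℝ (Fin 3)) p) = 3 := fun p ↦ by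
    change Module.finrank ℝ (EuclideanSpace ℝ (Fin 3)) = 3
    simp
  have hsec : ∀ (p : M) (u v : TangentSpace 𝓘(ℝ, EuclideanSpace ℝ (Fin 3)) p),
      S.g.form p u u * S.g.form p v v - S.g.form p u v ^ 2 ≠ 0 →
      S.g.form p (S.g.curvature p v v u) u =
        c / 2 * (S.g.form p u u * S.g.form p v v - S.g.form p u v ^ 2) := fun p u v huv ↦
    sectional_eq_of_ricci_eq (B := (S.g.form p).toLinearMap₁₂) (R := S.g.curvature p)
      (S.g.symm p) (S.g.nondegenerate p) (hdim p) (S.g.curvature_antisymm p)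
      (S.g.curvature_skew p) (hric p) huv
  refine ⟨⟨c, hric⟩, c / 2, ?_, fun p u v huv ↦ ?_⟩
  -- The constant is already known, so its sign can be read from one plane through `ξ` at one point.
  · obtain ⟨p⟩ : Nonempty M := inferInstance
    obtain ⟨A, hA, hAξ, hcurv⟩ :=
      S.g.exists_skew_of_unit_killing S.smooth_ξ hK S.form_ξ_ξ p
    have hξ : S.g.form p (S.ξ p) (S.ξ p) ≠ 0 := by simp [S.form_ξ_ξ]
    obtain ⟨u, hu, huu⟩ := exists_orthogonal_apply_self_ne_zero_of_one
      (B := (S.g.form p).toLinearMap₁₂) (S.g.symm p) (S.g.nondegenerate p) (hdim p) hξ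
    replace hu : S.g.form p (S.ξ p) u = 0 := hu
    replace huu : S.g.form p u u ≠ 0 := huu
    have hux : S.g.form p u (S.ξ p) = 0 := by rw [S.g.symm, hu]
    have hη : S.η p u = 0 := by rw [← S.form_ξ, hux]
    have huφ : S.g.form p u (S.φ p u) = 0 := by
      have h := S.form_φ_skew p u u
      rw [S.g.symm] at h
      linarith
    obtain ⟨t, ht⟩ := apply_self_of_skew (B := (S.g.form p).toLinearMap₁₂) (S.g.symm p)
      (S.g.nondegenerate p) (hdim p) (A := A) hA hξ hAξ huu (v := S.φ p u)
      (by simp [S.compatible, hη]) huφ hux (by simp [S.form_ξ, S.η_φ])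
    replace ht : S.g.form p (A u) (A u) = -t ^ 2 * S.g.form p u u := ht
    -- The plane of `u` and `ξ` has Gram determinant `g (u, u)`; its curvature numerator is both `c
    -- / 2 * g (u, u)` and `-t ^ 2 * g (u, u)`.
    have h := hsec p u (S.ξ p) (by simpa [S.form_ξ_ξ, hux] using huu)
    rw [hcurv, ht, S.form_ξ_ξ, hux] at h
    have h2 : -t ^ 2 = c / 2 := mul_right_cancel₀ huu (by linarith)
    rw [← h2]
    nlinarith [sq_nonneg t]
  · rw [PseudoRiemannianMetric.sectionalCurvature, hsec p u v huv]
    exact mul_div_cancel_right₀ _ huv
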